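/- Let $n\ge 1$, let $\Omega\subset\mathbb R^n$ be a bounded open convex set containing the origin, with $C^\infty$ boundary that is strictly convex in the sense that all principal curvatures of $\partial\Omega$ are positive, and let $k\in\mathbb R$ satisfy $n+k\ge 0$. Let $F:\overline\Omega\times(-\infty,0]\to[0,\infty)$ be a function such that 1. $F(x,s)>0$ for all $x\in\overline\Omega$ and $s<0$; 2. $F(x,ts)\ge t^{n+k}F(x,s)$ for all $x\in\overline\Omega$, $s\le 0$ and $0<t<1$; 3. there is $\delta>0$ such that the inequality in 2 is strict for all $x\in\overline\Omega$, $-\delta<s<0$ and $0<t<1$. For $u\in C^1(\Omega)$ write $u^\star(x)=\langle x,\nabla u(x)\rangle-u(x)$, and let $0<\alpha<1$. Then the Dirichlet problem $$(u^\star)^k\det D^2u=F(x,u)\ \text{ in }\Omega,\qquad u=0\ \text{ on }\partial\Omega,$$ has at most one convex solution $u\in C^{2,\alpha}(\overline\Omega)$ that is not identically zero. -/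

import Mathlib

open scoped Topology ContDiff

/-- The Hessian matrix `D²u(x) = (∂ᵢ∂ⱼ u(x))ᵢⱼ`. -/
noncomputable def hessian {n : ℕ} (u : EuclideanSpace ℝ (Fin n) → ℝ)
    (x : EuclideanSpace ℝ (Fin n)) : Matrix (Fin n) (Fin n) ℝ :=
  Matrix.of fun i j =>
    fderiv ℝ (fderiv ℝ u) x (EuclideanSpace.single i 1) (EuclideanSpace.single j 1)

/-- `u⋆(x) = ⟨x, ∇u(x)⟩ - u(x)`. -/
noncomputable def legendreStar {n : ℕ} (u : EuclideanSpace ℝ (Fin n) → ℝ)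
    (x : EuclideanSpace ℝ (Fin n)) : ℝ :=
  inner ℝ x (gradient u x) - u x

/-- A bounded open convex set with `C^∞` boundary whose principal curvatures are all positive.
The boundary is described by local smooth defining functions `ρ`; the positivity of the principal
curvatures at `x₀` says that `D²ρ(x₀)` is positive definite on the tangent space `ker dρ(x₀)`. -/
structure IsSmoothStrictlyConvexDomain {n : ℕ} (Ω : Set (EuclideanSpace ℝ (Fin n))) : Prop where
  isOpen : IsOpen Ω
  isBounded : Bornology.IsBounded Ω
  convex : Convex ℝ Ω
  boundary : ∀ x₀ ∈ frontier Ω, ∃ (U : Set (EuclideanSpace ℝ (Fin n)))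
    (ρ : EuclideanSpace ℝ (Fin n) → ℝ),
    IsOpen U ∧ x₀ ∈ U ∧ ContDiffOn ℝ ∞ ρ U ∧ (∀ x ∈ U, x ∈ Ω ↔ ρ x < 0) ∧
    fderiv ℝ ρ x₀ ≠ 0 ∧
    ∀ τ : EuclideanSpace ℝ (Fin n), τ ≠ 0 → fderiv ℝ ρ x₀ τ = 0 →
      0 < fderiv ℝ (fderiv ℝ ρ) x₀ τ τ

/-- `u ∈ C^{2,α}(Ω̄)`: `u` is continuous on `Ω̄`, of class `C²` in `Ω`, and its `C^{2,α}` norm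
is finite (for bounded convex `Ω` the derivatives then extend continuously to `Ω̄`). -/
def MemC2Alpha {n : ℕ} (α : ℝ) (Ω : Set (EuclideanSpace ℝ (Fin n)))
    (u : EuclideanSpace ℝ (Fin n) → ℝ) : Prop :=
  ContinuousOn u (closure Ω) ∧ ContDiffOn ℝ 2 u Ω ∧
  ∃ C : ℝ,
    (∀ x ∈ Ω, |u x| ≤ C ∧ ‖fderiv ℝ u x‖ ≤ C ∧ ‖fderiv ℝ (fderiv ℝ u) x‖ ≤ C) ∧
    ∀ x ∈ Ω, ∀ y ∈ Ω,
      ‖fderiv ℝ (fderiv ℝ u) x - fderiv ℝ (fderiv ℝ u) y‖ ≤ C * ‖x - y‖ ^ α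

/-- `u` is a convex solution of `(u⋆)^k det D²u = F(x, u)` in `Ω`, `u = 0` on `∂Ω`. -/
structure IsConvexSolution {n : ℕ} (k : ℝ) (Ω : Set (EuclideanSpace ℝ (Fin n)))
    (F : EuclideanSpace ℝ (Fin n) → ℝ → ℝ) (u : EuclideanSpace ℝ (Fin n) → ℝ) : Prop where
  convexOn : ConvexOn ℝ (closure Ω) u
  equation : ∀ x ∈ Ω, legendreStar u x ^ k * (hessian u x).det = F x (u x)
  boundary : ∀ x ∈ frontier Ω, u x = 0

/-! Write `Φ(w) = (w⋆)^k det D²w`, homogeneous of degree `n + k` under positive scaling. If `v > u`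
somewhere, let `t` be the infimum of `v / u`; then `0 < t < 1` and `z = t u - v ≥ 0`, with `t`
optimal. Wherever `u ≤ v` the ratio `v / u` lies in `[t, 1]`, so the scaling hypothesis and `n + k ≥
0` give `Φ(t u) ≤ Φ(v)`. This makes `z` a supersolution of an elliptic inequality with matrix `A =
(t D²u)⁻¹`, tested on functions touching `z` from below (`trace_inv_mul_hessian_le`).

There are two cases. If `z` vanishes inside `Ω`, the strong maximum principle
(`IsComparisonPair.eqOn_of_eq`) gives `v = t u`, which contradicts the strict scaling inequality
near the boundary. If `z > 0` in `Ω`, a Hopf estimate gives `z ≥ ε (-t u)`, that is `v ≤ t (1 + ε)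
u`, contradicting the optimality of `t` (`IsComparisonPair.exists_gt_le_mul`). Exchanging `u` and
`v` yields equality.

Since `F(x, 0)` may vanish, `D²u` may degenerate at the boundary and `A` may be unbounded there. The
barrier is therefore built from `a = -t u`, for which `tr(A D²a) = -n` exactly; otherwise only a
lower bound on `A` is needed, and it follows from the bound on `D²u`. The same lemma,
`exists_mul_le_of_viscosity`, also serves on interior balls. -/

/-! ### Trace and determinant inequalities for positive matrices -/

namespace Matrix

variable {ι : Type*} [Fintype ι] [DecidableEq ι]

open scoped MatrixOrder in
theorem PosSemidef.exists_eq_conjTranspose_mul_self {A : Matrix ι ι ℝ} (hA : A.PosSemidef) :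
    ∃ B : Matrix ι ι ℝ, A = Bᴴ * B :=
  CStarAlgebra.nonneg_iff_eq_star_mul_self.mp hA.nonneg

theorem PosSemidef.trace_mul_nonneg {A N : Matrix ι ι ℝ} (hA : A.PosSemidef)
    (hN : N.PosSemidef) : 0 ≤ (A * N).trace := by
  obtain ⟨B, rfl⟩ := hA.exists_eq_conjTranspose_mul_self
  rw [Matrix.mul_assoc, Matrix.trace_mul_comm]
  exact (hN.mul_mul_conjTranspose_same B).trace_nonneg

/-- Multiply the scalar inequalities `λ ≤ exp (λ - 1)` over the eigenvalues. -/
theorem PosSemidef.det_le_exp_trace_sub_card {M : Matrix ι ι ℝ} (hM : M.PosSemidef) :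
    M.det ≤ Real.exp (M.trace - Fintype.card ι) := by
  rw [hM.1.det_eq_prod_eigenvalues, hM.1.trace_eq_sum_eigenvalues]
  have : (∑ i, hM.1.eigenvalues i) - (Fintype.card ι : ℝ)
      = ∑ i, (hM.1.eigenvalues i - 1) := by simp
  simp only [RCLike.ofReal_real_eq_id, id]
  rw [this, Real.exp_sum]
  refine Finset.prod_le_prod (fun i _ => hM.eigenvalues_nonneg i) fun i _ => ?_
  have := Real.add_one_le_exp (hM.1.eigenvalues i - 1)
  linarith

/-- This is the tangent-plane inequality for the concave function `log det` at `P`, in a form that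
allows `det Q = 0`. With `P⁻¹ = Bᴴ B` it reduces to the previous bound for `B Q Bᴴ`. -/
theorem PosDef.det_le_det_mul_exp {P Q : Matrix ι ι ℝ} (hP : P.PosDef) (hQ : Q.PosSemidef) :
    Q.det ≤ P.det * Real.exp ((P⁻¹ * Q).trace - Fintype.card ι) := by
  obtain ⟨B, hB⟩ := hP.inv.posSemidef.exists_eq_conjTranspose_mul_self
  have h1 := (hQ.mul_mul_conjTranspose_same B).det_le_exp_trace_sub_card
  have h2 : (B * Q * Bᴴ).trace = (P⁻¹ * Q).trace := by
    rw [hB, Matrix.trace_mul_comm, Matrix.mul_assoc]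
  have h3 : P.det * (B * Q * Bᴴ).det = Q.det := by
    have h4 : P.det * (Bᴴ * B).det = 1 := by
      rw [← hB, ← det_mul, mul_nonsing_inv _ hP.det_pos.ne'.isUnit, det_one]
    rw [det_mul] at h4
    rw [det_mul, det_mul]
    linear_combination Q.det * h4
  rw [h2] at h1
  rw [← h3]
  exact mul_le_mul_of_nonneg_left h1 hP.det_pos.le

theorem PosDef.le_dotProduct_inv_mulVec {P : Matrix ι ι ℝ} (hP : P.PosDef) {C : ℝ} (hC : 0 < C)
    (hPC : ∀ y, y ⬝ᵥ P *ᵥ y ≤ C * (y ⬝ᵥ y)) (y : ι → ℝ) :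
    (y ⬝ᵥ y) / C ≤ y ⬝ᵥ P⁻¹ *ᵥ y := by
  set μ := P⁻¹ *ᵥ y with hμ
  have hPμ : P *ᵥ μ = y := by
    rw [hμ, mulVec_mulVec, mul_nonsing_inv _ hP.det_pos.ne'.isUnit, one_mulVec]
  have hsymm : μ ⬝ᵥ P *ᵥ y = y ⬝ᵥ y := by
    have hT : Pᵀ = P := by simpa using hP.1.eq
    rw [dotProduct_mulVec, ← mulVec_transpose, hT, hPμ]
  -- Expanding this square and bounding its `C⁻² yᵀPy` term by `C⁻¹ |y|²` gives the claim without
  -- diagonalizing.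
  have h0 : 0 ≤ (μ - C⁻¹ • y) ⬝ᵥ P *ᵥ (μ - C⁻¹ • y) := by
    simpa using hP.posSemidef.dotProduct_mulVec_nonneg (μ - C⁻¹ • y)
  simp only [mulVec_sub, mulVec_smul, hPμ, sub_dotProduct, dotProduct_sub, smul_dotProduct,
    dotProduct_smul, smul_eq_mul, hsymm] at h0
  have h1 := mul_le_mul_of_nonneg_left (hPC y) (by positivity : 0 ≤ C⁻¹ * C⁻¹)
  have h2 : C⁻¹ * C⁻¹ * (C * (y ⬝ᵥ y)) = C⁻¹ * (y ⬝ᵥ y) := by field_simp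
  rw [dotProduct_comm y μ, div_eq_inv_mul]
  linarith

end Matrix

/-! ### Second-order conditions at minima and for convex functions -/

section Calculus

variable {E : Type*} [NormedAddCommGroup E] [NormedSpace ℝ E]

/-- A negative second derivative would make `a` a local maximum too, so `g` would be locally
constant and the second derivative zero. -/
theorem IsLocalMin.deriv_deriv_nonneg {g : ℝ → ℝ} {a : ℝ} (h : IsLocalMin g a)
    (hc : ContinuousAt g a) : 0 ≤ deriv (deriv g) a := by
  by_contra! hneg
  have hmax := isLocalMax_of_deriv_deriv_neg hneg h.deriv_eq_zero hc
  have heq : g =ᶠ[𝓝 a] fun _ => g a := by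
    filter_upwards [h, hmax] with x hx hy using le_antisymm hy hx
  have := heq.deriv.deriv_eq
  simp at this
  linarith

theorem ContDiffAt.differentiableAt_fderiv {f : E → ℝ} {p : E} (hf : ContDiffAt ℝ 2 f p) :
    DifferentiableAt ℝ (fderiv ℝ f) p :=
  (hf.fderiv_right (m := 1) (by norm_num)).differentiableAt (by norm_num)

theorem ContDiffAt.eventually_differentiableAt {f : E → ℝ} {p : E} (hf : ContDiffAt ℝ 2 f p) :
    ∀ᶠ x in 𝓝 p, DifferentiableAt ℝ f x := by
  filter_upwards [hf.eventually (by norm_num)] with x hx using hx.differentiableAt (by norm_num)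

theorem IsLocalMin.fderiv_fderiv_nonneg {f : E → ℝ} {p : E} (h : IsLocalMin f p)
    (hf : ContDiffAt ℝ 2 f p) (ξ : E) : 0 ≤ fderiv ℝ (fderiv ℝ f) p ξ ξ := by
  have hline : ∀ s : ℝ, HasDerivAt (fun s : ℝ => p + s • ξ) ξ s := fun s => by
    simpa using ((hasDerivAt_id s).smul_const ξ).const_add p
  have hcont : Filter.Tendsto (fun s : ℝ => p + s • ξ) (𝓝 0) (𝓝 p) := by
    simpa using (hline 0).continuousAt.tendsto
  have hmin : IsLocalMin (fun s : ℝ => f (p + s • ξ)) 0 := by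
    simpa [IsLocalMin, IsMinFilter] using hcont.eventually h
  have hd : deriv (fun s : ℝ => f (p + s • ξ)) =ᶠ[𝓝 0] fun s => fderiv ℝ f (p + s • ξ) ξ := by
    filter_upwards [hcont.eventually hf.eventually_differentiableAt] with s hs
    exact (hs.hasFDerivAt.comp_hasDerivAt s (hline s)).deriv
  have hdd : HasDerivAt (fun s : ℝ => fderiv ℝ f (p + s • ξ) ξ)
      (fderiv ℝ (fderiv ℝ f) p ξ ξ) 0 := by
    have h1 : HasFDerivAt (fderiv ℝ f) (fderiv ℝ (fderiv ℝ f) p) (p + (0 : ℝ) • ξ) := by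
      simpa using hf.differentiableAt_fderiv.hasFDerivAt
    have h2 := h1.comp_hasDerivAt (0 : ℝ) (hline 0)
    simpa using h2.clm_apply (hasDerivAt_const (0 : ℝ) ξ)
  have := hmin.deriv_deriv_nonneg (by
    have : ContinuousAt f (p + (0 : ℝ) • ξ) := by simpa using hf.continuousAt
    exact ContinuousAt.comp (f := fun s : ℝ => p + s • ξ) this (hline 0).continuousAt)
  rwa [hd.deriv_eq, hdd.deriv] at this

theorem ConvexOn.fderiv_sub_le {s : Set E} {f : E → ℝ} (hf : ConvexOn ℝ s f) {p x : E}
    (hp : p ∈ s) (hx : x ∈ s) (hd : DifferentiableAt ℝ f p) :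
    fderiv ℝ f p (x - p) ≤ f x - f p := by
  have hg : ConvexOn ℝ (Set.Icc 0 1) (f ∘ AffineMap.lineMap (k := ℝ) p x) :=
    (hf.comp_affineMap _).subset (fun s hs => hf.1.lineMap_mem hp hx hs) (convex_Icc 0 1)
  have h1 : HasDerivAt (f ∘ AffineMap.lineMap (k := ℝ) p x) (fderiv ℝ f p (x - p)) 0 := by
    refine HasFDerivAt.comp_hasDerivAt (0 : ℝ) ?_ AffineMap.hasDerivAt_lineMap
    simpa using hd.hasFDerivAt
  simpa [slope] using hg.le_slope_of_hasDerivAt (x := 0) (y := 1) (by simp) (by simp) one_pos h1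

theorem ConvexOn.fderiv_fderiv_nonneg {s : Set E} {f : E → ℝ} (hf : ConvexOn ℝ s f) {p : E}
    (hs : s ∈ 𝓝 p) (hd : ContDiffAt ℝ 2 f p) (ξ : E) :
    0 ≤ fderiv ℝ (fderiv ℝ f) p ξ ξ := by
  -- Subtracting the linear part of the supporting plane turns `p` into a minimum without changing
  -- the Hessian.
  have hmin : IsLocalMin (f - ⇑(fderiv ℝ f p)) p := by
    filter_upwards [hs] with x hx
    have := hf.fderiv_sub_le (mem_of_mem_nhds hs) hx (hd.differentiableAt (by norm_num))
    simp only [map_sub, Pi.sub_apply] at this ⊢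
    linarith
  have h := hmin.fderiv_fderiv_nonneg (hd.sub (fderiv ℝ f p).contDiff.contDiffAt) ξ
  have h2 : fderiv ℝ (f - ⇑(fderiv ℝ f p)) =ᶠ[𝓝 p] fun x => fderiv ℝ f x - fderiv ℝ f p := by
    filter_upwards [hd.eventually_differentiableAt] with x hx
    rw [fderiv_sub hx (fderiv ℝ f p).differentiableAt, ContinuousLinearMap.fderiv]
  rwa [h2.fderiv_eq, fderiv_sub_const] at h

end Calculus

/-! ### Hessian matrices of combinations and of `a + K a²` -/

section Hessian

open scoped Matrix

variable {n : ℕ} {f g : EuclideanSpace ℝ (Fin n) → ℝ} {p : EuclideanSpace ℝ (Fin n)}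

theorem dotProduct_hessian_mulVec (f : EuclideanSpace ℝ (Fin n) → ℝ)
    (p : EuclideanSpace ℝ (Fin n)) (y : Fin n → ℝ) :
    y ⬝ᵥ hessian f p *ᵥ y
      = fderiv ℝ (fderiv ℝ f) p (WithLp.toLp 2 y) (WithLp.toLp 2 y) := by
  have hy : WithLp.toLp 2 y = ∑ i, y i • EuclideanSpace.single i (1 : ℝ) := by
    ext j; simp [Finset.sum_apply, Pi.single_apply]
  rw [hy]
  simp only [hessian, dotProduct, Matrix.mulVec, Matrix.of_apply, map_sum, map_smul,
    sum_apply, smul_apply, smul_eq_mul, Finset.mul_sum]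
  rw [Finset.sum_comm]
  refine Finset.sum_congr rfl fun i _ => Finset.sum_congr rfl fun j _ => by ring

theorem isHermitian_hessian (hf : ContDiffAt ℝ 2 f p) : (hessian f p).IsHermitian := by
  ext i j
  simpa [hessian] using (hf.isSymmSndFDerivAt (by simp)) _ _

theorem posSemidef_hessian (hf : ContDiffAt ℝ 2 f p)
    (h : ∀ ξ, 0 ≤ fderiv ℝ (fderiv ℝ f) p ξ ξ) : (hessian f p).PosSemidef :=
  .of_dotProduct_mulVec_nonneg (isHermitian_hessian hf) fun y => by
    simpa [dotProduct_hessian_mulVec] using h _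

theorem hessian_sub (hf : ContDiffAt ℝ 2 f p) (hg : ContDiffAt ℝ 2 g p) :
    hessian (fun x => f x - g x) p = hessian f p - hessian g p := by
  have h : fderiv ℝ (fun x => f x - g x) =ᶠ[𝓝 p] fun x => fderiv ℝ f x - fderiv ℝ g x := by
    filter_upwards [hf.eventually_differentiableAt, hg.eventually_differentiableAt] with x hx hy
    exact fderiv_fun_sub hx hy
  ext i j
  simp [hessian, h.fderiv_eq, fderiv_fun_sub hf.differentiableAt_fderiv hg.differentiableAt_fderiv]

theorem hessian_const_mul (hf : ContDiffAt ℝ 2 f p) (c : ℝ) :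
    hessian (fun x => c * f x) p = c • hessian f p := by
  have h : fderiv ℝ (fun x => c * f x) =ᶠ[𝓝 p] fun x => c • fderiv ℝ f x := by
    filter_upwards [hf.eventually_differentiableAt] with x hx
    exact fderiv_const_mul hx c
  ext i j
  simp [hessian, h.fderiv_eq, fderiv_fun_const_smul hf.differentiableAt_fderiv]

theorem fderiv_add_mul_sq {a : EuclideanSpace ℝ (Fin n) → ℝ} (ha : DifferentiableAt ℝ a p)
    (K : ℝ) : fderiv ℝ (fun x => a x + K * a x ^ 2) p = (1 + 2 * K * a p) • fderiv ℝ a p := by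
  have h := ha.hasFDerivAt.add ((ha.hasFDerivAt.pow 2).const_mul K)
  refine (h.congr_fderiv ?_).fderiv
  ext y
  simp
  ring

theorem hessian_add_mul_sq {a : EuclideanSpace ℝ (Fin n) → ℝ} (ha : ContDiffAt ℝ 2 a p) (K : ℝ) :
    hessian (fun x => a x + K * a x ^ 2) p = (1 + 2 * K * a p) • hessian a p
      + (2 * K) • Matrix.vecMulVec (fun i => fderiv ℝ a p (EuclideanSpace.single i 1))
        (fun i => fderiv ℝ a p (EuclideanSpace.single i 1)) := by
  have h : fderiv ℝ (fun x => a x + K * a x ^ 2)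
      =ᶠ[𝓝 p] fun x => (1 + 2 * K * a x) • fderiv ℝ a x := by
    filter_upwards [ha.eventually_differentiableAt] with x hx
    exact fderiv_add_mul_sq hx K
  have h2 : HasFDerivAt (fun x => 1 + 2 * K * a x) ((2 * K) • fderiv ℝ a p) p :=
    ((ha.differentiableAt (by norm_num)).hasFDerivAt.const_mul (2 * K)).const_add 1
  have h3 := h2.fun_smul ha.differentiableAt_fderiv.hasFDerivAt
  ext i j
  simp only [hessian, h.fderiv_eq, h3.fderiv, Matrix.of_apply, Matrix.add_apply,
    Matrix.smul_apply, Matrix.vecMulVec_apply]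
  simp
  ring

theorem dotProduct_apply_single_self (L : EuclideanSpace ℝ (Fin n) →L[ℝ] ℝ) :
    (fun i => L (EuclideanSpace.single i 1)) ⬝ᵥ (fun i => L (EuclideanSpace.single i 1))
      = ‖L‖ ^ 2 := by
  obtain ⟨y, rfl⟩ := (InnerProductSpace.toDual ℝ (EuclideanSpace ℝ (Fin n))).surjective L
  simp only [InnerProductSpace.toDual_apply_apply, EuclideanSpace.inner_single_right,
    LinearIsometryEquiv.norm_map, EuclideanSpace.norm_sq_eq, dotProduct]
  simp [pow_two]

theorem legendreStar_eq (f : EuclideanSpace ℝ (Fin n) → ℝ) (p : EuclideanSpace ℝ (Fin n)) :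
    legendreStar f p = fderiv ℝ f p p - f p := by
  rw [legendreStar, gradient, real_inner_comm, InnerProductSpace.toDual_symm_apply]

end Hessian

theorem Real.abs_log_sub_log_le {a b m : ℝ} (hm : 0 < m) (ha : m ≤ a) (hb : m ≤ b) :
    |Real.log a - Real.log b| ≤ |a - b| / m := by
  have key : ∀ {x y : ℝ}, m ≤ x → m ≤ y → Real.log x - Real.log y ≤ |x - y| / m := by
    intro x y hx hy
    have hx0 : 0 < x := hm.trans_le hx
    have hy0 : 0 < y := hm.trans_le hy
    rw [← Real.log_div hx0.ne' hy0.ne']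
    calc Real.log (x / y) ≤ x / y - 1 := Real.log_le_sub_one_of_pos (div_pos hx0 hy0)
      _ = (x - y) / y := by field_simp
      _ ≤ |x - y| / y := by gcongr; exact le_abs_self _
      _ ≤ |x - y| / m := by gcongr
  rw [abs_le]
  have h1 := key ha hb
  have h2 := key hb ha
  rw [abs_sub_comm] at h2
  constructor <;> linarith

/-! ### The linearized inequality and the Hopf barrier -/

section Comparison

variable {n : ℕ}

/-- At the touching point `D²v ≤ t D²u - D²φ`, so concavity of `log det` bounds `det D²v` by `det (t
D²u) exp(-T)`, with `T` the trace to be estimated. Taking logarithms in `Φ(t u) ≤ Φ(v)` leaves `T ≤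
k (log v⋆ - log (t u⋆))`. The logarithm is Lipschitz above `m`, and by the first-order condition `t
u⋆ - v⋆` involves only `∇φ` and the values of `t u - v`. -/
theorem trace_inv_mul_hessian_le {k t m A B : ℝ} {u v φ : EuclideanSpace ℝ (Fin n) → ℝ}
    {p : EuclideanSpace ℝ (Fin n)} (hu : ContDiffAt ℝ 2 u p) (hv : ContDiffAt ℝ 2 v p)
    (hφ : ContDiffAt ℝ 2 φ p) (ht : 0 < t)
    (hmin : IsLocalMin (fun x => (t * u x - v x) - φ x) p)
    (hP : (hessian u p).PosDef) (hQ : (hessian v p).PosSemidef)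
    (hA : legendreStar u p ^ k * (hessian u p).det = A)
    (hB : legendreStar v p ^ k * (hessian v p).det = B)
    (hAB : t ^ ((n : ℝ) + k) * A ≤ B) (hm : 0 < m) (hmu : m ≤ t * legendreStar u p)
    (hmv : m ≤ legendreStar v p) :
    ((t • hessian u p)⁻¹ * hessian φ p).trace
      ≤ |k| / m * |fderiv ℝ φ p p - (t * u p - v p)| := by
  have hw : ContDiffAt ℝ 2 (fun x => t * u x) p := contDiffAt_const.mul hu
  have hz : ContDiffAt ℝ 2 (fun x => t * u x - v x) p := hw.sub hv
  have hP' : (t • hessian u p).PosDef := hP.smul ht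
  have hus : 0 < legendreStar u p := by
    by_contra! h
    nlinarith
  have hvs : 0 < legendreStar v p := hm.trans_le hmv
  set T := ((t • hessian u p)⁻¹ * hessian φ p).trace with hT
  -- first order condition
  have hfd : t * fderiv ℝ u p p - fderiv ℝ v p p = fderiv ℝ φ p p := by
    have h1 := hmin.fderiv_eq_zero
    rw [fderiv_fun_sub (hz.differentiableAt (by norm_num)) (hφ.differentiableAt (by norm_num)),
      fderiv_fun_sub (hw.differentiableAt (by norm_num)) (hv.differentiableAt (by norm_num)),
      fderiv_const_mul (hu.differentiableAt (by norm_num))] at h1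
    have h2 := DFunLike.congr_fun h1 p
    simp at h2
    linarith
  -- second order condition
  have hpsd : (t • hessian u p - hessian v p - hessian φ p).PosSemidef := by
    have := posSemidef_hessian (hz.sub hφ) (hmin.fderiv_fderiv_nonneg (hz.sub hφ))
    rwa [hessian_sub hz hφ, hessian_sub hw hv, hessian_const_mul hu] at this
  have htr : ((t • hessian u p)⁻¹ * hessian v p).trace - n ≤ -T := by
    have h1 := hP'.inv.posSemidef.trace_mul_nonneg hpsd
    rw [Matrix.mul_sub, Matrix.mul_sub, Matrix.nonsing_inv_mul _ hP'.det_pos.ne'.isUnit,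
      Matrix.trace_sub, Matrix.trace_sub, Matrix.trace_one, Fintype.card_fin, ← hT] at h1
    linarith
  have hdet : (hessian v p).det ≤ (t • hessian u p).det * Real.exp (-T) := by
    refine (hP'.det_le_det_mul_exp hQ).trans ?_
    rw [Fintype.card_fin]
    exact mul_le_mul_of_nonneg_left (Real.exp_le_exp.mpr htr) hP'.det_pos.le
  have hmain : (t * legendreStar u p) ^ k ≤ legendreStar v p ^ k * Real.exp (-T) := by
    have h1 : (t * legendreStar u p) ^ k * (t • hessian u p).det
        = t ^ ((n : ℝ) + k) * A := by
      rw [← hA, Real.mul_rpow ht.le hus.le, Matrix.det_smul, Fintype.card_fin,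
        Real.rpow_add ht, Real.rpow_natCast]
      ring
    refine le_of_mul_le_mul_right ?_ hP'.det_pos
    calc (t * legendreStar u p) ^ k * (t • hessian u p).det ≤ B := h1 ▸ hAB
      _ = legendreStar v p ^ k * (hessian v p).det := hB.symm
      _ ≤ legendreStar v p ^ k * ((t • hessian u p).det * Real.exp (-T)) := by gcongr
      _ = _ := by ring
  have hlog : k * Real.log (t * legendreStar u p) ≤ k * Real.log (legendreStar v p) - T := by
    have h1 := Real.log_le_log (Real.rpow_pos_of_pos (mul_pos ht hus) k) hmain
    rwa [Real.log_mul (Real.rpow_pos_of_pos hvs k).ne' (Real.exp_pos _).ne', Real.log_exp,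
      Real.log_rpow hvs, Real.log_rpow (mul_pos ht hus)] at h1
  calc T ≤ k * (Real.log (legendreStar v p) - Real.log (t * legendreStar u p)) := by linarith
    _ ≤ |k| * |Real.log (legendreStar v p) - Real.log (t * legendreStar u p)| := by
        rw [← abs_mul]; exact le_abs_self _
    _ ≤ |k| * (|legendreStar v p - t * legendreStar u p| / m) := by
        gcongr; exact Real.abs_log_sub_log_le hm hmv hmu
    _ = |k| / m * |fderiv ℝ φ p p - (t * u p - v p)| := by
        rw [abs_sub_comm, legendreStar_eq, legendreStar_eq, ← hfd]
        rw [show t * (fderiv ℝ u p p - u p) - (fderiv ℝ v p p - v p)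
          = t * fderiv ℝ u p p - fderiv ℝ v p p - (t * u p - v p) by ring]
        ring

open scoped Matrix in
/-- A Hopf-type boundary lemma. The degenerate elliptic inequality satisfied by `z` enters only
through the viscosity-type hypothesis `hvisc` on test functions touching `z` from below. -/
theorem exists_mul_le_of_viscosity {X : Set (EuclideanSpace ℝ (Fin n))}
    {a z : EuclideanSpace ℝ (Fin n) → ℝ}
    {A : EuclideanSpace ℝ (Fin n) → Matrix (Fin n) (Fin n) ℝ}
    {σ₀ ε₀ c c₀ C₁ C₂ R : ℝ} (hX : IsCompact X) (ha : ContinuousOn a X)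
    (ha0 : ∀ x ∈ X, 0 ≤ a x) (hO : ∀ x ∈ X, 0 < a x → X ∈ 𝓝 x)
    (haC : ∀ x ∈ X, 0 < a x → ContDiffAt ℝ 2 a x)
    (hz : ContinuousOn z X) (hz0 : ∀ x ∈ X, 0 ≤ z x) (hzpos : ∀ x ∈ X, 0 < a x → 0 < z x)
    (hσ₀ : 0 < σ₀) (hε₀ : 0 < ε₀) (hc : 0 ≤ c) (hc₀ : 0 < c₀) (hC₁ : 0 ≤ C₁) (hC₂ : 0 ≤ C₂)
    (hR : ∀ x ∈ X, ‖x‖ ≤ R)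
    (hvisc : ∀ φ : EuclideanSpace ℝ (Fin n) → ℝ, ∀ p ∈ X, 0 < a p → ContDiffAt ℝ 2 φ p →
      IsLocalMin (fun x => z x - φ x) p → z p ≤ ε₀ * a p →
      (A p * hessian φ p).trace ≤ c * |fderiv ℝ φ p p - z p|)
    (htr : ∀ p ∈ X, 0 < a p → a p < σ₀ → -C₁ ≤ (A p * hessian a p).trace)
    (hgrad : ∀ p ∈ X, 0 < a p → a p < σ₀ →
      c₀ ≤ (fun i => fderiv ℝ a p (EuclideanSpace.single i 1)) ⬝ᵥ
        A p *ᵥ (fun i => fderiv ℝ a p (EuclideanSpace.single i 1)))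
    (hbd : ∀ p ∈ X, 0 < a p → a p < σ₀ → ‖fderiv ℝ a p‖ ≤ C₂) :
    ∃ ε > 0, ∀ x ∈ X, ε * a x ≤ z x := by
  rcases X.eq_empty_or_nonempty with rfl | ⟨x₁, hx₁⟩
  · exact ⟨1, one_pos, by simp⟩
  have hR0 : 0 ≤ R := (norm_nonneg _).trans (hR x₁ hx₁)
  -- The barrier is `ε (a + K a²)`. `K` is chosen so that the term `2 K ⟨A∇a, ∇a⟩` beats the trace
  -- term and the lower-order terms with margin `1`.
  set K := (3 * C₁ + c * (3 * C₂ * R + 2) + 1) / (2 * c₀) with hK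
  have hKpos : 0 < K := by positivity
  have hKc : 2 * K * c₀ = 3 * C₁ + c * (3 * C₂ * R + 2) + 1 := by
    rw [hK]; field_simp
  -- On `a ≤ σ` one has `K a ≤ 1`, hence `1 + 2 K a ≤ 3` and `a + K a² ≤ 2 a`.
  set σ := min σ₀ (min 1 (1 / K)) with hσ
  have hσpos : 0 < σ := by positivity
  have hσ1 : σ ≤ 1 := (min_le_right _ _).trans (min_le_left _ _)
  have hσK : K * σ ≤ 1 := by
    have : σ ≤ 1 / K := (min_le_right _ _).trans (min_le_right _ _)
    rw [le_div_iff₀ hKpos] at this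
    linarith
  have hcpt : IsCompact (X ∩ a ⁻¹' Set.Ici σ) :=
    hX.of_isClosed_subset (ha.preimage_isClosed_of_isClosed hX.isClosed isClosed_Ici)
      Set.inter_subset_left
  obtain ⟨m₀, hm₀, hm₀z⟩ := hcpt.exists_forall_le' (hz.mono Set.inter_subset_left) (a := 0)
    fun x hx => hzpos x hx.1 (hσpos.trans_le hx.2)
  obtain ⟨B, hB⟩ := hX.exists_bound_of_continuousOn ha
  have hB0 : 0 ≤ B := (norm_nonneg _).trans (hB x₁ hx₁)
  -- The first entry keeps the barrier below `z` on `a = σ`; the second puts any point where the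
  -- barrier exceeds `z` in the range where `hvisc` applies.
  set ε := min (m₀ / (2 * (B + 1))) (ε₀ / 2) with hε
  have hεpos : 0 < ε := by positivity
  have hεm : ∀ x ∈ X, 2 * ε * a x ≤ m₀ := fun x hx => by
    have h1 : ε ≤ m₀ / (2 * (B + 1)) := min_le_left _ _
    rw [le_div_iff₀ (by positivity)] at h1
    have h2 := (le_abs_self _).trans (hB x hx)
    nlinarith
  have hεε : 2 * ε ≤ ε₀ := by
    have : ε ≤ ε₀ / 2 := min_le_right _ _
    linarith
  refine ⟨ε, hεpos, fun x hx => ?_⟩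
  rcases le_total σ (a x) with hσx | hσx
  · have h1 := hm₀z x ⟨hx, hσx⟩
    have h2 := hεm x hx
    have h3 := mul_nonneg hεpos.le (ha0 x hx)
    linarith
  suffices h : ε * (a x + K * a x ^ 2) ≤ z x by
    refine le_trans ?_ h
    have : 0 ≤ K * a x ^ 2 := by positivity
    gcongr
    linarith
  have hD : IsCompact (X ∩ a ⁻¹' Set.Iic σ) :=
    hX.of_isClosed_subset (ha.preimage_isClosed_of_isClosed hX.isClosed isClosed_Iic)
      Set.inter_subset_left
  obtain ⟨p, ⟨hpX, hpσ⟩, hpmin⟩ := hD.exists_isMinOn ⟨x, hx, hσx⟩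
    (f := fun x => z x - ε * (a x + K * a x ^ 2))
    (((hz.sub ((ha.add ((ha.pow 2).const_mul K)).const_mul ε))).mono Set.inter_subset_left)
  have hpx : z p - ε * (a p + K * a p ^ 2) ≤ z x - ε * (a x + K * a x ^ 2) := hpmin ⟨hx, hσx⟩
  by_contra! hlt
  have hp0 : z p < ε * (a p + K * a p ^ 2) := by linarith
  have hap0 := ha0 p hpX
  rw [Set.mem_preimage, Set.mem_Iic] at hpσ
  have hKa : K * a p ≤ 1 := (mul_le_mul_of_nonneg_left hpσ hKpos.le).trans hσK
  have hp2 : ε * (a p + K * a p ^ 2) ≤ 2 * ε * a p := by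
    have : K * a p ^ 2 ≤ a p := by nlinarith
    nlinarith
  -- The negative minimum can lie neither on `a = 0`, where `z ≥ 0`, nor on `a = σ`, where `z ≥ m₀`;
  -- hence it is a local minimum and the barrier is an admissible test function.
  have hapos : 0 < a p := by
    refine hap0.lt_of_ne' fun h => ?_
    have := hz0 p hpX
    simp [h] at hp0
    linarith
  have hapσ : a p < σ := by
    refine hpσ.lt_of_ne fun h => ?_
    have := hm₀z p ⟨hpX, h.ge⟩
    have := hεm p hpX
    linarith
  have hacd := haC p hpX hapos
  have hloc : IsLocalMin (fun x => z x - ε * (a x + K * a x ^ 2)) p := by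
    filter_upwards [hO p hpX hapos, hacd.continuousAt.eventually_lt continuousAt_const hapσ]
      with y hy hy' using hpmin ⟨hy, hy'.le⟩
  have hhC : ContDiffAt ℝ 2 (fun x => a x + K * a x ^ 2) p :=
    hacd.add (contDiffAt_const.mul (hacd.pow 2))
  have hkey := hvisc _ p hpX hapos (contDiffAt_const.mul hhC) hloc (by nlinarith)
  rw [hessian_const_mul hhC, hessian_add_mul_sq hacd,
    fderiv_const_mul (hhC.differentiableAt (by norm_num)),
    fderiv_add_mul_sq (hacd.differentiableAt (by norm_num))] at hkey
  simp only [Matrix.mul_smul, Matrix.mul_add, Matrix.trace_smul, Matrix.trace_add,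
    Matrix.mul_vecMulVec, Matrix.trace_vecMulVec, smul_eq_mul, smul_apply] at hkey
  rw [dotProduct_comm] at hkey
  have hσσ : a p < σ₀ := hapσ.trans_le (min_le_left _ _)
  have h1 := htr p hpX hapos hσσ
  have h2 := hgrad p hpX hapos hσσ
  have h3 := hbd p hpX hapos hσσ
  set τ := (A p * hessian a p).trace
  set γ := (fun i => fderiv ℝ a p (EuclideanSpace.single i 1)) ⬝ᵥ
        A p *ᵥ (fun i => fderiv ℝ a p (EuclideanSpace.single i 1))
  have h4 : |fderiv ℝ a p p| ≤ C₂ * R := by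
    refine ((fderiv ℝ a p).le_opNorm p).trans ?_
    exact mul_le_mul h3 (hR p hpX) (norm_nonneg _) hC₂
  have h5 : |ε * ((1 + 2 * K * a p) * fderiv ℝ a p p) - z p| ≤ ε * (3 * C₂ * R + 2) := by
    have h6 : |ε * ((1 + 2 * K * a p) * fderiv ℝ a p p)| ≤ ε * (3 * C₂ * R) := by
      have h7 : 0 ≤ 1 + 2 * K * a p := by positivity
      rw [abs_mul, abs_mul, abs_of_pos hεpos, abs_of_nonneg h7]
      refine mul_le_mul_of_nonneg_left ?_ hεpos.le
      calc (1 + 2 * K * a p) * |fderiv ℝ a p p| ≤ 3 * (C₂ * R) :=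
            mul_le_mul (by linarith) h4 (abs_nonneg _) (by norm_num)
        _ = _ := by ring
    have h8 : |z p| ≤ ε * 2 := by
      rw [abs_of_nonneg (hz0 p hpX)]
      have : a p ≤ 1 := hpσ.trans hσ1
      nlinarith
    calc _ ≤ _ := abs_sub _ _
      _ ≤ _ := add_le_add h6 h8
      _ = _ := by ring
  have h9 : ε * ((1 + 2 * K * a p) * τ + 2 * K * γ) ≤ ε * (c * (3 * C₂ * R + 2)) := by
    refine hkey.trans ((mul_le_mul_of_nonneg_left h5 hc).trans_eq ?_)
    ring
  have h10 := le_of_mul_le_mul_left h9 hεpos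
  have h11 : -(3 * C₁) ≤ (1 + 2 * K * a p) * τ := by
    have h7 : 0 ≤ 1 + 2 * K * a p := by positivity
    have := mul_le_mul_of_nonneg_left h1 h7
    nlinarith
  have h12 : 2 * K * c₀ ≤ 2 * K * γ := by gcongr
  linarith

end Comparison

/-! ### Convex functions with zero boundary values -/

section Convex

variable {E : Type*} [NormedAddCommGroup E] [NormedSpace ℝ E] {Ω : Set E}

theorem exists_frontier_eq_convex_combination (hΩ : IsOpen Ω) (hb : Bornology.IsBounded Ω)
    {q x : E} (hx : x ∈ Ω) (hne : x ≠ q) :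
    ∃ p ∈ frontier Ω, ∃ θ : ℝ, 0 < θ ∧ θ < 1 ∧ x = (1 - θ) • q + θ • p := by
  set ℓ : ℝ → E := fun s => q + s • (x - q) with hℓ
  have hℓc : Continuous ℓ := by fun_prop
  have h1 : (1 : ℝ) ∈ ℓ ⁻¹' Ω := by simpa [hℓ] using hx
  have hxq : 0 < ‖x - q‖ := norm_pos_iff.mpr (sub_ne_zero.mpr hne)
  have hbdd : BddAbove (ℓ ⁻¹' Ω) := by
    obtain ⟨R, hR⟩ := hb.exists_norm_le
    refine ⟨(R + ‖q‖) / ‖x - q‖, fun s hs => ?_⟩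
    rw [le_div_iff₀ hxq]
    calc s * ‖x - q‖ ≤ ‖s • (x - q)‖ := by
          rw [norm_smul]
          exact mul_le_mul_of_nonneg_right (Real.le_norm_self s) (norm_nonneg _)
      _ = ‖ℓ s - q‖ := by simp [hℓ]
      _ ≤ ‖ℓ s‖ + ‖q‖ := norm_sub_le _ _
      _ ≤ R + ‖q‖ := by gcongr; exact hR _ hs
  -- The exit parameter of the ray from `q` through `x`; openness puts `ℓ S` outside `Ω` and forces
  -- `S > 1`.
  set S := sSup (ℓ ⁻¹' Ω) with hS
  have hnot : ℓ S ∉ Ω := fun h => by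
    obtain ⟨ε, hε, hball⟩ := Metric.isOpen_iff.mp (hΩ.preimage hℓc) S h
    have : S + ε / 2 ∈ ℓ ⁻¹' Ω := hball (by simp [abs_of_pos hε, hε])
    have := le_csSup hbdd this
    linarith
  have hcl : ℓ S ∈ closure Ω :=
    (closure_mono (Set.image_preimage_subset ℓ Ω))
      (image_closure_subset_closure_image hℓc ⟨S, csSup_mem_closure ⟨1, h1⟩ hbdd, rfl⟩)
  have hS1 : 1 < S := (le_csSup hbdd h1).lt_of_ne fun h => hnot (by rw [hS, ← h]; exact h1)
  have hS0 : 0 < S := one_pos.trans hS1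
  refine ⟨ℓ S, ?_, S⁻¹, inv_pos.mpr hS0, inv_lt_one_of_one_lt₀ hS1, ?_⟩
  · rw [hΩ.frontier_eq]
    exact ⟨hcl, hnot⟩
  · simp only [hℓ, smul_add, smul_smul, inv_mul_cancel₀ hS0.ne', sub_smul, one_smul]
    abel

theorem ConvexOn.le_mul_of_frontier_eq_zero {u : E → ℝ} (hu : ConvexOn ℝ (closure Ω) u)
    (hbd : ∀ x ∈ frontier Ω, u x = 0) {p q : E} (hp : p ∈ frontier Ω) (hq : q ∈ Ω) {θ : ℝ}
    (h0 : 0 < θ) (h1 : θ < 1) : u ((1 - θ) • q + θ • p) ≤ (1 - θ) * u q := by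
  have := hu.2 (subset_closure hq) (frontier_subset_closure hp) (by linarith : 0 ≤ 1 - θ) h0.le
    (by ring)
  simpa [hbd p hp] using this

/-- An interior maximum point `m` lies strictly between another point `y` and the frontier, so `u m
≤ (1 - θ) u y ≤ (1 - θ) u m` and `u m ≤ 0`. Negativity then spreads from one point along segments to
the frontier. -/
theorem ConvexOn.neg_of_frontier_eq_zero [FiniteDimensional ℝ E] [Nontrivial E] (hΩ : IsOpen Ω)
    (hb : Bornology.IsBounded Ω) {u : E → ℝ} (hu : ConvexOn ℝ (closure Ω) u)
    (huc : ContinuousOn u (closure Ω)) (hbd : ∀ x ∈ frontier Ω, u x = 0)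
    (hne : ∃ x ∈ Ω, u x ≠ 0) {x : E} (hx : x ∈ Ω) : u x < 0 := by
  have : ProperSpace E := FiniteDimensional.proper ℝ E
  obtain ⟨q, hq, huq⟩ := hne
  have hle : ∀ y ∈ closure Ω, u y ≤ 0 := by
    obtain ⟨m, hm, hmax⟩ := hb.isCompact_closure.exists_isMaxOn ⟨q, subset_closure hq⟩ huc
    suffices h : u m ≤ 0 from fun y hy => (hmax hy).trans h
    by_cases hmΩ : m ∈ Ω
    · have := Module.punctured_nhds_neBot ℝ E m
      obtain ⟨y, hy, hyΩ⟩ := (dense_compl_singleton m).exists_mem_open hΩ ⟨m, hmΩ⟩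
      obtain ⟨p, hp, θ, h0, h1, hmp⟩ :=
        exists_frontier_eq_convex_combination hΩ hb hmΩ (Ne.symm hy : m ≠ y)
      have h2 := hu.le_mul_of_frontier_eq_zero hbd hp hyΩ h0 h1
      rw [← hmp] at h2
      have h3 : u y ≤ u m := hmax (subset_closure hyΩ)
      nlinarith
    · exact (hbd m (hΩ.frontier_eq ▸ ⟨hm, hmΩ⟩)).le
  have hq0 : u q < 0 := (hle q (subset_closure hq)).lt_of_ne huq
  rcases eq_or_ne x q with rfl | hxq
  · exact hq0
  · obtain ⟨p, hp, θ, h0, h1, hxp⟩ := exists_frontier_eq_convex_combination hΩ hb hx hxq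
    have h2 := hu.le_mul_of_frontier_eq_zero hbd hp hq h0 h1
    rw [← hxp] at h2
    nlinarith

/-- A negative convex function with zero boundary values is bounded above by a positive multiple of
any function with zero boundary values and bounded gradient. -/
theorem exists_le_mul_of_frontier_eq_zero [FiniteDimensional ℝ E] (hΩ : IsOpen Ω)
    (hb : Bornology.IsBounded Ω) (hconv : Convex ℝ Ω) (h0 : (0 : E) ∈ Ω) {u v : E → ℝ} {C : ℝ}
    (huc : ContinuousOn u (closure Ω)) (hud : ∀ x ∈ Ω, DifferentiableAt ℝ u x)
    (huC : ∀ x ∈ Ω, ‖fderiv ℝ u x‖ ≤ C) (hub : ∀ x ∈ frontier Ω, u x = 0)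
    (hv : ConvexOn ℝ (closure Ω) v) (hvb : ∀ x ∈ frontier Ω, v x = 0) (hu0 : u 0 < 0)
    (hv0 : v 0 < 0) : ∃ c > 0, ∀ x ∈ Ω, v x ≤ c * u x := by
  have hC : 0 ≤ C := (norm_nonneg _).trans (huC 0 h0)
  have hlip : LipschitzOnWith ⟨C, hC⟩ u (closure Ω) :=
    LipschitzOnWith.closure huc (hconv.lipschitzOnWith_of_nnnorm_fderiv_le (𝕜 := ℝ) hud
      fun x hx => huC x hx)
  obtain ⟨R, hR⟩ := hb.closure.exists_norm_le
  have hR0 : 0 ≤ R := (norm_nonneg _).trans (hR 0 (subset_closure h0))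
  -- Along a segment from `0` to the frontier, `-u ≤ C R (1 - θ)` by the Lipschitz bound and `-v ≥
  -- (1 - θ) (-v 0)` by convexity. The first entry handles the origin itself.
  set c := min (v 0 / u 0) (-v 0 / (C * R + 1)) with hc
  have hc0 : 0 < c := lt_min (div_pos_of_neg_of_neg hv0 hu0) (div_pos (by linarith) (by positivity))
  refine ⟨c, hc0, fun x hx => ?_⟩
  rcases eq_or_ne x 0 with rfl | hx0
  · exact (le_div_iff_of_neg hu0).mp (min_le_left _ _)
  · obtain ⟨p, hp, θ, hθ0, hθ1, hxp⟩ := exists_frontier_eq_convex_combination hΩ hb hx hx0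
    have h1 := hv.le_mul_of_frontier_eq_zero hvb hp h0 hθ0 hθ1
    rw [← hxp] at h1
    have h2 := hlip.dist_le_mul x (subset_closure hx) p (frontier_subset_closure hp)
    have h3 : x - p = -((1 - θ) • p) := by
      rw [hxp, smul_zero, zero_add, sub_smul, one_smul, neg_sub]
    rw [Real.dist_eq, hub p hp, sub_zero, dist_eq_norm, h3, norm_neg, norm_smul, Real.norm_eq_abs,
      abs_of_pos (by linarith : 0 < 1 - θ)] at h2
    have h4 : -(u x) ≤ C * ((1 - θ) * R) := (neg_le_abs _).trans (h2.trans (by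
      change C * _ ≤ _
      have := hR p (frontier_subset_closure hp)
      have : 0 ≤ 1 - θ := by linarith
      gcongr))
    have h5 : c * (C * R + 1) ≤ -v 0 := by
      rw [← le_div_iff₀ (by positivity)]
      exact min_le_right _ _
    have h6 : c * -(u x) ≤ (1 - θ) * -v 0 := by
      calc c * -(u x) ≤ c * (C * ((1 - θ) * R)) := by gcongr
        _ = (1 - θ) * (c * (C * R)) := by ring
        _ ≤ (1 - θ) * -v 0 := by
          have : 0 ≤ 1 - θ := by linarith
          gcongr
          linarith
    linarith

end Convex

/-! ### Comparison pairs and the boundary Hopf estimate -/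

section Solution

variable {n : ℕ} {Ω : Set (EuclideanSpace ℝ (Fin n))} {u v : EuclideanSpace ℝ (Fin n) → ℝ}

/-- The supporting plane at `p`, evaluated at the origin, has height `-u⋆(p)`. When `u 0 < 0` this
is a uniform positive lower bound, which makes `log u⋆` harmless. -/
theorem ConvexOn.neg_le_legendreStar (hu : ConvexOn ℝ (closure Ω) u)
    (h0 : (0 : EuclideanSpace ℝ (Fin n)) ∈ Ω) {p : EuclideanSpace ℝ (Fin n)} (hp : p ∈ Ω)
    (hd : DifferentiableAt ℝ u p) : -u 0 ≤ legendreStar u p := by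
  have := hu.fderiv_sub_le (subset_closure hp) (subset_closure h0) hd
  rw [zero_sub, map_neg] at this
  rw [legendreStar_eq]
  linarith

theorem ConvexOn.posSemidef_hessian (hu : ConvexOn ℝ (closure Ω) u) (hΩ : IsOpen Ω)
    {p : EuclideanSpace ℝ (Fin n)} (hp : p ∈ Ω) (hd : ContDiffAt ℝ 2 u p) :
    (hessian u p).PosSemidef :=
  _root_.posSemidef_hessian hd
    (hu.fderiv_fderiv_nonneg (Filter.mem_of_superset (hΩ.mem_nhds hp) subset_closure) hd)

theorem ConvexOn.posDef_hessian (hu : ConvexOn ℝ (closure Ω) u) (hΩ : IsOpen Ω)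
    {p : EuclideanSpace ℝ (Fin n)} (hp : p ∈ Ω) (hd : ContDiffAt ℝ 2 u p) {k : ℝ}
    (h : 0 < legendreStar u p ^ k * (hessian u p).det) : (hessian u p).PosDef := by
  rw [(hu.posSemidef_hessian hΩ hp hd).posDef_iff_det_ne_zero]
  rintro h1
  simp [h1] at h

theorem dotProduct_hessian_mulVec_le {C : ℝ} {p : EuclideanSpace ℝ (Fin n)}
    (hC : ‖fderiv ℝ (fderiv ℝ u) p‖ ≤ C) (y : Fin n → ℝ) :
    dotProduct y ((hessian u p).mulVec y) ≤ C * dotProduct y y := by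
  rw [dotProduct_hessian_mulVec]
  have hy : dotProduct y y = ‖WithLp.toLp 2 y‖ * ‖WithLp.toLp 2 y‖ := by
    rw [← pow_two, EuclideanSpace.norm_sq_eq]
    simp [dotProduct, pow_two]
  rw [hy, ← mul_assoc]
  refine (le_abs_self _).trans (((fderiv ℝ (fderiv ℝ u) p).le_opNorm₂ _ _).trans ?_)
  gcongr

theorem continuousOn_hessian (hΩ : IsOpen Ω) (hu : ContDiffOn ℝ 2 u Ω) :
    ContinuousOn (hessian u) Ω := by
  have h1 : ContinuousOn (fderiv ℝ (fderiv ℝ u)) Ω :=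
    ((hu.fderiv_of_isOpen hΩ (m := 1) (by norm_num)).continuousOn_fderiv_of_isOpen hΩ le_rfl)
  refine continuousOn_pi.mpr fun i => continuousOn_pi.mpr fun j => ?_
  exact (h1.clm_apply continuousOn_const).clm_apply continuousOn_const

/-- `v ≤ t u < 0` are convex functions with zero boundary values which satisfy the differential
inequality `Φ(t u) ≤ Φ(v)`, `Φ(w) = (w⋆)^k det D²w`, wherever `u ≤ v`. -/
structure IsComparisonPair (k t : ℝ) (Ω : Set (EuclideanSpace ℝ (Fin n)))
    (u v : EuclideanSpace ℝ (Fin n) → ℝ) : Prop where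
  isOpen : IsOpen Ω
  isBounded : Bornology.IsBounded Ω
  convex : Convex ℝ Ω
  zero_mem : (0 : EuclideanSpace ℝ (Fin n)) ∈ Ω
  pos : 0 < t
  lt_one : t < 1
  continuousOn_left : ContinuousOn u (closure Ω)
  continuousOn_right : ContinuousOn v (closure Ω)
  contDiffAt_left : ∀ x ∈ Ω, ContDiffAt ℝ 2 u x
  contDiffAt_right : ∀ x ∈ Ω, ContDiffAt ℝ 2 v x
  convexOn_left : ConvexOn ℝ (closure Ω) u
  convexOn_right : ConvexOn ℝ (closure Ω) v
  frontier_left : ∀ x ∈ frontier Ω, u x = 0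
  frontier_right : ∀ x ∈ frontier Ω, v x = 0
  neg_left : ∀ x ∈ Ω, u x < 0
  neg_right : ∀ x ∈ Ω, v x < 0
  posDef : ∀ x ∈ Ω, (hessian u x).PosDef
  bound : ∃ C > 0, ∀ x ∈ Ω, ‖fderiv ℝ u x‖ ≤ C ∧ ‖fderiv ℝ (fderiv ℝ u) x‖ ≤ C
  le_mul : ∀ x ∈ Ω, v x ≤ t * u x
  inequality : ∀ x ∈ Ω, u x ≤ v x →
    t ^ ((n : ℝ) + k) * (legendreStar u x ^ k * (hessian u x).det)
      ≤ legendreStar v x ^ k * (hessian v x).det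

namespace IsComparisonPair

variable {k t : ℝ}

theorem exists_viscosity (h : IsComparisonPair k t Ω u v) : ∃ c, 0 ≤ c ∧
    ∀ φ : EuclideanSpace ℝ (Fin n) → ℝ, ∀ p ∈ Ω, ContDiffAt ℝ 2 φ p →
      IsLocalMin (fun x => (t * u x - v x) - φ x) p → u p ≤ v p →
      ((t • hessian u p)⁻¹ * hessian φ p).trace
        ≤ c * |fderiv ℝ φ p p - (t * u p - v p)| := by
  have hu0 := h.neg_left 0 h.zero_mem
  have hv0 := h.neg_right 0 h.zero_mem
  have hm : 0 < min (t * -u 0) (-v 0) :=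
    lt_min (mul_pos h.pos (by linarith)) (by linarith)
  refine ⟨|k| / min (t * -u 0) (-v 0), by positivity, fun φ p hp hφ hmin hle => ?_⟩
  have hud := h.contDiffAt_left p hp
  have hvd := h.contDiffAt_right p hp
  refine trace_inv_mul_hessian_le hud hvd hφ h.pos hmin (h.posDef p hp)
    (h.convexOn_right.posSemidef_hessian h.isOpen hp hvd) rfl rfl (h.inequality p hp hle) hm ?_ ?_
  · refine (min_le_left _ _).trans (mul_le_mul_of_nonneg_left ?_ h.pos.le)
    exact h.convexOn_left.neg_le_legendreStar h.zero_mem hp (hud.differentiableAt (by norm_num))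
  · refine (min_le_right _ _).trans ?_
    exact h.convexOn_right.neg_le_legendreStar h.zero_mem hp (hvd.differentiableAt (by norm_num))

open scoped Matrix in
-- The upper bound on `D²u` gives a lower ellipticity bound for its inverse, uniform up to the
-- boundary.
theorem exists_le_dotProduct (h : IsComparisonPair k t Ω u v) : ∃ C > 0, ∀ p ∈ Ω,
    ∀ L : EuclideanSpace ℝ (Fin n) →L[ℝ] ℝ, ‖L‖ ^ 2 / C ≤
      (fun i => L (EuclideanSpace.single i 1)) ⬝ᵥ
        (t • hessian u p)⁻¹ *ᵥ (fun i => L (EuclideanSpace.single i 1)) := by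
  obtain ⟨C, hC, hbd⟩ := h.bound
  refine ⟨t * C, mul_pos h.pos hC, fun p hp L => ?_⟩
  rw [← dotProduct_apply_single_self]
  refine ((h.posDef p hp).smul h.pos).le_dotProduct_inv_mulVec (mul_pos h.pos hC) (fun y => ?_) _
  rw [Matrix.smul_mulVec, dotProduct_smul, smul_eq_mul, mul_assoc]
  exact mul_le_mul_of_nonneg_left (dotProduct_hessian_mulVec_le (hbd p hp).2 y) h.pos.le

theorem mem_of_ne_zero (h : IsComparisonPair k t Ω u v) {x : EuclideanSpace ℝ (Fin n)}
    (hx : x ∈ closure Ω) (hux : u x ≠ 0) : x ∈ Ω := by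
  by_contra hn
  exact hux (h.frontier_left x (h.isOpen.frontier_eq ▸ ⟨hx, hn⟩))

/-- If `v < t u` in `Ω` then `v ≤ t' u` for some `t' > t`. -/
theorem exists_gt_le_mul (h : IsComparisonPair k t Ω u v) (hlt : ∀ x ∈ Ω, v x < t * u x) :
    ∃ t' > t, ∀ x ∈ Ω, v x ≤ t' * u x := by
  obtain ⟨c, hc, hvisc⟩ := h.exists_viscosity
  obtain ⟨C, hC, hdot⟩ := h.exists_le_dotProduct
  obtain ⟨C', hC', hbd⟩ := h.bound
  obtain ⟨R, hR0, hR⟩ := h.isBounded.closure.exists_pos_norm_le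
  have ht := h.pos
  have hu0 := h.neg_left 0 h.zero_mem
  have hΩ : ∀ x ∈ closure Ω, 0 < -t * u x → x ∈ Ω := fun x hx hpos =>
    h.mem_of_ne_zero hx fun h0 => by simp [h0] at hpos
  -- A lower bound for `‖∇a‖` near the boundary: where `-u < -u 0 / 2`, the bound `u⋆ ≥ -u 0` gives
  -- `⟨p, ∇u⟩ ≥ -u 0 / 2`, while `‖p‖ ≤ R`.
  set d := t * -u 0 / (2 * R) with hd
  have hdpos : 0 < d := div_pos (mul_pos ht (by linarith)) (by positivity)
  obtain ⟨ε, hε, hle⟩ := exists_mul_le_of_viscosity (X := closure Ω) (a := fun x => -t * u x)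
    (z := fun x => t * u x - v x) (A := fun x => (t • hessian u x)⁻¹) (σ₀ := t * -u 0 / 2)
    (ε₀ := (1 - t) / t) (c := c) (c₀ := d ^ 2 / C) (C₁ := n) (C₂ := t * C') (R := R)
    h.isBounded.isCompact_closure (h.continuousOn_left.const_mul _)
    (fun x hx => by
      by_cases hxΩ : x ∈ Ω
      · have := h.neg_left x hxΩ
        nlinarith
      · simp [h.frontier_left x (h.isOpen.frontier_eq ▸ ⟨hx, hxΩ⟩)])
    (fun x hx hpos =>
      Filter.mem_of_superset (h.isOpen.mem_nhds (hΩ x hx hpos)) subset_closure)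
    (fun x hx hpos => contDiffAt_const.mul (h.contDiffAt_left x (hΩ x hx hpos)))
    ((h.continuousOn_left.const_mul _).sub h.continuousOn_right)
    (fun x hx => by
      by_cases hxΩ : x ∈ Ω
      · exact sub_nonneg.mpr (h.le_mul x hxΩ)
      · have hf : x ∈ frontier Ω := h.isOpen.frontier_eq ▸ ⟨hx, hxΩ⟩
        simp [h.frontier_left x hf, h.frontier_right x hf])
    (fun x hx hpos => sub_pos.mpr (hlt x (hΩ x hx hpos)))
    (half_pos (mul_pos ht (by linarith))) (div_pos (by linarith [h.lt_one]) ht) hc (by positivity)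
    (Nat.cast_nonneg n) (by positivity) hR
    (fun φ p hp hpos hφ hmin hz => hvisc φ p (hΩ p hp hpos) hφ hmin (by
      -- With this `ε₀`, the condition `z ≤ ε₀ a` says exactly `u ≤ v`, where the differential
      -- inequality is available.
      have h1 : (1 - t) / t * (-t * u p) = (1 - t) * -u p := by field_simp
      rw [h1] at hz
      linarith))
    (fun p hp hpos _ => by
      have hpΩ := hΩ p hp hpos
      rw [hessian_const_mul (h.contDiffAt_left p hpΩ), neg_smul, Matrix.mul_neg,
        Matrix.nonsing_inv_mul _ ((h.posDef p hpΩ).smul ht).det_pos.ne'.isUnit]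
      simp)
    (fun p hp hpos hσ => by
      have hpΩ := hΩ p hp hpos
      have hdiff := (h.contDiffAt_left p hpΩ).differentiableAt (by norm_num)
      refine le_trans ?_ (hdot p hpΩ _)
      gcongr
      rw [fderiv_const_mul hdiff, neg_smul, norm_neg, norm_smul, Real.norm_eq_abs, abs_of_pos ht,
        hd, div_le_iff₀ (by positivity)]
      have h1 := h.convexOn_left.neg_le_legendreStar h.zero_mem hpΩ hdiff
      rw [legendreStar_eq] at h1
      have h2 : fderiv ℝ u p p ≤ ‖fderiv ℝ u p‖ * R :=
        (le_abs_self _).trans (((fderiv ℝ u p).le_opNorm p).trans (by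
          have := hR p hp
          gcongr))
      have h3 : -u p < -u 0 / 2 := by
        refine lt_of_mul_lt_mul_left ?_ ht.le
        linarith
      have h4 : -u 0 ≤ ‖fderiv ℝ u p‖ * (2 * R) := by linarith
      rw [mul_assoc]
      gcongr)
    (fun p hp hpos _ => by
      have hpΩ := hΩ p hp hpos
      rw [fderiv_const_mul ((h.contDiffAt_left p hpΩ).differentiableAt (by norm_num)), neg_smul,
        norm_neg, norm_smul, Real.norm_eq_abs, abs_of_pos ht]
      exact mul_le_mul_of_nonneg_left (hbd p hpΩ).1 ht.le)
  refine ⟨t * (1 + ε), by nlinarith, fun x hx => ?_⟩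
  have := hle x (subset_closure hx)
  linarith

end IsComparisonPair

end Solution

/-! ### Derivatives of the ball barrier `r² - ‖x - c‖²` -/

section Distance

variable {n : ℕ}

theorem fderiv_sq_sub_norm_sq (r : ℝ) (c : EuclideanSpace ℝ (Fin n)) :
    fderiv ℝ (fun x => r ^ 2 - ‖x - c‖ ^ 2) = fun x => -((2 : ℝ) • innerSL ℝ (x - c)) := by
  funext x
  have h := (((hasFDerivAt_id x).sub_const c).norm_sq).const_sub (r ^ 2)
  refine (h.congr_fderiv ?_).fderiv
  ext y
  simp

theorem norm_fderiv_sq_sub_norm_sq (r : ℝ) (c x : EuclideanSpace ℝ (Fin n)) :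
    ‖fderiv ℝ (fun x => r ^ 2 - ‖x - c‖ ^ 2) x‖ = 2 * ‖x - c‖ := by
  rw [fderiv_sq_sub_norm_sq, norm_neg, norm_smul, innerSL_apply_norm]
  simp

theorem hessian_sq_sub_norm_sq (r : ℝ) (c x : EuclideanSpace ℝ (Fin n)) :
    hessian (fun x => r ^ 2 - ‖x - c‖ ^ 2) x = (-2 : ℝ) • 1 := by
  have h : HasFDerivAt (fun x : EuclideanSpace ℝ (Fin n) => -((2 : ℝ) • innerSL ℝ (x - c)))
      (-((2 : ℝ) • (innerSL ℝ : EuclideanSpace ℝ (Fin n) →L[ℝ] _))) x := by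
    have h1 : HasFDerivAt (fun x : EuclideanSpace ℝ (Fin n) => innerSL ℝ (x - c))
        (innerSL ℝ : EuclideanSpace ℝ (Fin n) →L[ℝ] _) x :=
      (innerSL ℝ : EuclideanSpace ℝ (Fin n) →L[ℝ] _).hasFDerivAt.comp x
        ((hasFDerivAt_id x).sub_const c)
    exact (h1.const_smul (2 : ℝ)).neg
  ext i j
  rw [hessian, Matrix.of_apply, fderiv_sq_sub_norm_sq, h.fderiv]
  change -(2 * inner ℝ (EuclideanSpace.single i (1 : ℝ)) (EuclideanSpace.single j (1 : ℝ))) = _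
  by_cases hij : i = j <;> simp [hij, EuclideanSpace.inner_single_left]

end Distance

/-! ### Interior Hopf lemma and strong maximum principle -/

namespace IsComparisonPair

variable {n : ℕ} {Ω : Set (EuclideanSpace ℝ (Fin n))} {u v : EuclideanSpace ℝ (Fin n) → ℝ}
  {k t : ℝ}

/-- On a closed ball inside `Ω` the inverse Hessian is bounded by compactness, so the explicit
barrier `r² - ‖x - c‖²` can replace `-t u`. -/
theorem exists_mul_le_of_ball (h : IsComparisonPair k t Ω u v) {c : EuclideanSpace ℝ (Fin n)}
    {r : ℝ} (hr : 0 < r) (hball : Metric.closedBall c r ⊆ Ω)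
    (hlt : ∀ x ∈ Metric.ball c r, v x < t * u x) :
    ∃ ε > 0, ∀ x ∈ Metric.closedBall c r, ε * (r ^ 2 - ‖x - c‖ ^ 2) ≤ t * u x - v x := by
  obtain ⟨c₁, hc₁, hvisc⟩ := h.exists_viscosity
  obtain ⟨C, hC, hdot⟩ := h.exists_le_dotProduct
  obtain ⟨R, hR0, hR⟩ := h.isBounded.closure.exists_pos_norm_le
  have ht := h.pos
  have hX : IsCompact (Metric.closedBall c r) := isCompact_closedBall c r
  have hcl : Metric.closedBall c r ⊆ closure Ω := hball.trans subset_closure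
  have hu2 : ContDiffOn ℝ 2 u Ω := fun x hx => (h.contDiffAt_left x hx).contDiffWithinAt
  -- Since `-u ≥ μ` on the ball, `z ≤ (1 - t) μ` forces `u ≤ v`; this fixes `ε₀`.
  obtain ⟨μ, hμ, hμu⟩ := hX.exists_forall_le' (h.continuousOn_left.neg.mono hcl) (a := 0)
    fun x hx => by simpa using h.neg_left x (hball hx)
  have htrace : ContinuousOn (fun x => ((t • hessian u x)⁻¹ * ((-2 : ℝ) • 1)).trace)
      (Metric.closedBall c r) := by
    have h1 : ContinuousOn (fun x => t • hessian u x) (Metric.closedBall c r) :=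
      ((continuousOn_hessian h.isOpen hu2).mono hball).const_smul t
    have hdet : Continuous fun M : Matrix (Fin n) (Fin n) ℝ => M.det :=
      continuous_id.matrix_det
    have hadj : Continuous fun M : Matrix (Fin n) (Fin n) ℝ => M.adjugate :=
      continuous_id.matrix_adjugate
    have h2 : ContinuousOn (fun x => (t • hessian u x)⁻¹) (Metric.closedBall c r) := by
      simp only [Matrix.inv_def, Ring.inverse_eq_inv']
      have hinv : ContinuousOn (fun x => (t • hessian u x).det⁻¹) (Metric.closedBall c r) :=
        (hdet.comp_continuousOn h1).inv₀ fun x hx =>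
          ((h.posDef x (hball hx)).smul ht).det_pos.ne'
      exact hinv.smul (hadj.comp_continuousOn h1)
    have hmul : Continuous fun M : Matrix (Fin n) (Fin n) ℝ =>
        M * ((-2 : ℝ) • (1 : Matrix (Fin n) (Fin n) ℝ)) := continuous_id.matrix_mul continuous_const
    have h3 : Continuous fun M : Matrix (Fin n) (Fin n) ℝ => (M * ((-2 : ℝ) • 1)).trace :=
      hmul.matrix_trace
    exact h3.comp_continuousOn h2
  obtain ⟨C₁, hC₁⟩ := hX.exists_bound_of_continuousOn htrace
  have hC₁0 : 0 ≤ C₁ := (norm_nonneg _).trans (hC₁ c (Metric.mem_closedBall_self hr.le))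
  have hac : ContDiff ℝ 2 fun x : EuclideanSpace ℝ (Fin n) => r ^ 2 - ‖x - c‖ ^ 2 :=
    contDiff_const.sub ((contDiff_id.sub contDiff_const).norm_sq ℝ)
  have hmem : ∀ x, 0 < r ^ 2 - ‖x - c‖ ^ 2 → x ∈ Metric.ball c r := fun x hx => by
    rw [mem_ball_iff_norm]
    exact lt_of_pow_lt_pow_left₀ 2 hr.le (by linarith)
  refine exists_mul_le_of_viscosity (a := fun x => r ^ 2 - ‖x - c‖ ^ 2)
    (z := fun x => t * u x - v x) (A := fun x => (t • hessian u x)⁻¹) (σ₀ := r ^ 2 / 2)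
    (ε₀ := (1 - t) * μ / r ^ 2) (c := c₁) (c₀ := 2 * r ^ 2 / C) (C₁ := C₁) (C₂ := 2 * r) (R := R)
    hX hac.continuous.continuousOn
    (fun x hx => ?_)
    (fun x _ hpos => Filter.mem_of_superset (Metric.isOpen_ball.mem_nhds (hmem x hpos))
      Metric.ball_subset_closedBall)
    (fun x _ _ => hac.contDiffAt)
    (((h.continuousOn_left.const_mul _).sub h.continuousOn_right).mono hcl)
    (fun x hx => sub_nonneg.mpr (h.le_mul x (hball hx)))
    (fun x _ hpos => sub_pos.mpr (hlt x (hmem x hpos)))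
    (by positivity) (div_pos (mul_pos (by linarith [h.lt_one]) hμ) (by positivity)) hc₁
    (by positivity) hC₁0 (by positivity) (fun x hx => hR x (hcl hx))
    (fun φ p hp hpos hφ hmin hz => hvisc φ p (hball hp) hφ hmin ?_)
    (fun p hp _ _ => ?_) (fun p hp _ hσ => ?_) (fun p hp _ _ => ?_)
  · rw [mem_closedBall_iff_norm] at hx
    have := pow_le_pow_left₀ (norm_nonneg _) hx 2
    linarith
  · have h1 : (1 - t) * μ / r ^ 2 * (r ^ 2 - ‖p - c‖ ^ 2) ≤ (1 - t) * μ := by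
      have h2 : 0 ≤ (1 - t) * μ := mul_nonneg (by linarith [h.lt_one]) hμ.le
      calc _ ≤ (1 - t) * μ / r ^ 2 * r ^ 2 := by
            gcongr
            linarith [sq_nonneg ‖p - c‖]
        _ = _ := by field_simp
    have h3 : (1 - t) * μ ≤ (1 - t) * -u p :=
      mul_le_mul_of_nonneg_left (hμu p hp) (by linarith [h.lt_one])
    linarith
  · rw [hessian_sq_sub_norm_sq]
    exact (abs_le.mp (hC₁ p hp)).1
  · refine le_trans ?_ (hdot p (hball hp) _)
    rw [norm_fderiv_sq_sub_norm_sq]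
    gcongr
    linarith
  · rw [norm_fderiv_sq_sub_norm_sq]
    rw [mem_closedBall_iff_norm] at hp
    linarith

/-- At a contact point `z` attains its minimum `0`, so its gradient vanishes; but the barrier gives
slope at least `ε r²` along the segment to the center. -/
theorem ne_of_mem_sphere (h : IsComparisonPair k t Ω u v) {c : EuclideanSpace ℝ (Fin n)}
    {r : ℝ} (hr : 0 < r) (hball : Metric.closedBall c r ⊆ Ω)
    (hlt : ∀ x ∈ Metric.ball c r, v x < t * u x) {x₀ : EuclideanSpace ℝ (Fin n)}
    (hx₀ : x₀ ∈ Metric.sphere c r) : v x₀ ≠ t * u x₀ := by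
  intro heq
  obtain ⟨ε, hε, hle⟩ := h.exists_mul_le_of_ball hr hball hlt
  have hxΩ : x₀ ∈ Ω := hball (Metric.sphere_subset_closedBall hx₀)
  rw [mem_sphere_iff_norm] at hx₀
  have hmin : IsLocalMin (fun x => t * u x - v x) x₀ := by
    filter_upwards [h.isOpen.mem_nhds hxΩ] with x hx
    have := h.le_mul x hx
    linarith
  have hdiff : DifferentiableAt ℝ (fun x => t * u x - v x) x₀ :=
    (((h.contDiffAt_left x₀ hxΩ).differentiableAt (by norm_num)).const_mul t).sub
      ((h.contDiffAt_right x₀ hxΩ).differentiableAt (by norm_num))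
  have hderiv : HasDerivAt (fun s : ℝ => t * u (x₀ + s • (c - x₀)) - v (x₀ + s • (c - x₀))) 0 0 := by
    have h1 : HasDerivAt (fun s : ℝ => x₀ + s • (c - x₀)) (c - x₀) 0 := by
      simpa using ((hasDerivAt_id (0 : ℝ)).smul_const (c - x₀)).const_add x₀
    have h2 : HasFDerivAt (fun x => t * u x - v x) (0 : EuclideanSpace ℝ (Fin n) →L[ℝ] ℝ)
        (x₀ + (0 : ℝ) • (c - x₀)) := by
      simpa [hmin.fderiv_eq_zero] using hdiff.hasFDerivAt
    exact h2.comp_hasDerivAt (0 : ℝ) h1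
  have hslope := hderiv.tendsto_slope_zero_right
  have hge : ∀ᶠ s : ℝ in 𝓝[>] 0, ε * r ^ 2 ≤ s⁻¹ • ((t * u (x₀ + (0 + s) • (c - x₀))
      - v (x₀ + (0 + s) • (c - x₀))) - (t * u (x₀ + (0 : ℝ) • (c - x₀))
      - v (x₀ + (0 : ℝ) • (c - x₀)))) := by
    filter_upwards [Ioo_mem_nhdsGT (zero_lt_one' ℝ)] with s hs
    have h1 : ‖x₀ + s • (c - x₀) - c‖ = (1 - s) * r := by
      rw [show x₀ + s • (c - x₀) - c = (1 - s) • (x₀ - c) by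
        rw [sub_smul, one_smul, smul_sub, smul_sub]; abel, norm_smul, hx₀, Real.norm_eq_abs,
        abs_of_pos (by linarith [hs.2])]
    have h2 := hle (x₀ + s • (c - x₀)) (by
      rw [mem_closedBall_iff_norm, h1]
      nlinarith [hs.1])
    rw [h1] at h2
    rw [zero_add, zero_smul, add_zero, heq, sub_self, sub_zero, smul_eq_mul, inv_mul_eq_div,
      le_div_iff₀ hs.1]
    refine le_trans ?_ h2
    rw [mul_assoc]
    refine mul_le_mul_of_nonneg_left ?_ hε.le
    nlinarith [mul_nonneg (mul_nonneg hs.1.le (by linarith [hs.2] : 0 ≤ 1 - s)) (sq_nonneg r)]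
  have := ge_of_tendsto hslope hge
  have : 0 < ε * r ^ 2 := by positivity
  linarith

/-- The strong maximum principle: if `v = t u` somewhere in `Ω` then `v = t u` in `Ω`. -/
theorem eqOn_of_eq (h : IsComparisonPair k t Ω u v) {x₁ : EuclideanSpace ℝ (Fin n)}
    (hx₁ : x₁ ∈ Ω) (heq : v x₁ = t * u x₁) : ∀ x ∈ Ω, v x = t * u x := by
  have hcont : ContinuousOn (fun x => t * u x - v x) Ω :=
    ((h.continuousOn_left.const_mul t).sub h.continuousOn_right).mono subset_closure
  set W := Ω ∩ (fun x => t * u x - v x) ⁻¹' {0}ᶜ with hW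
  have hWo : IsOpen W := hcont.isOpen_inter_preimage h.isOpen isOpen_compl_singleton
  have hmemW : ∀ x ∈ Ω, x ∉ W → v x = t * u x := fun x hx hxW => by
    by_contra hne
    exact hxW ⟨hx, fun h0 => hne (by linarith [show t * u x - v x = 0 from h0])⟩
  have hltW : ∀ x ∈ W, v x < t * u x := fun x hx =>
    (h.le_mul x hx.1).lt_of_ne fun h0 => hx.2 (by simp [h0])
  have hclosed : closure W ∩ Ω ⊆ W := by
    rintro x ⟨hxcl, hx⟩
    by_contra hxW
    obtain ⟨ρ, hρ, hρΩ⟩ := Metric.isOpen_iff.mp h.isOpen x hx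
    -- Choosing `c` within `ρ / 3` of `x` keeps the ball about `c` reaching the nearest contact
    -- point within `2ρ / 3` of `x`. That ball lies in `Ω`, its interior lies in `W`, and it touches
    -- the contact set on its sphere.
    obtain ⟨c, hcW, hcx⟩ := Metric.mem_closure_iff.mp hxcl (ρ / 3) (by positivity)
    have hYc : IsCompact (Metric.closedBall x (2 * ρ / 3) \ W) :=
      (isCompact_closedBall x (2 * ρ / 3)).diff hWo
    have hxY : x ∈ Metric.closedBall x (2 * ρ / 3) \ W :=
      ⟨Metric.mem_closedBall_self (by positivity), hxW⟩
    obtain ⟨x₀, hx₀, hmin⟩ := hYc.exists_isMinOn ⟨x, hxY⟩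
      (f := fun y => dist y c) (by fun_prop)
    have hr : 0 < dist x₀ c := dist_pos.mpr fun h0 => hx₀.2 (h0 ▸ hcW)
    have hrx : dist x₀ c ≤ dist x c := hmin hxY
    have hnear : ∀ y ∈ Metric.closedBall c (dist x₀ c), dist y x ≤ 2 * ρ / 3 := fun y hy => by
      have h1 := dist_triangle y c x
      rw [Metric.mem_closedBall] at hy
      rw [dist_comm c x] at h1
      linarith
    have hball : Metric.closedBall c (dist x₀ c) ⊆ Ω := fun y hy =>
      hρΩ (Metric.mem_ball.mpr (by linarith [hnear y hy]))
    refine h.ne_of_mem_sphere hr hball (fun y hy => ?_) (Metric.mem_sphere.mpr rfl)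
      (hmemW x₀ (hball (Metric.mem_closedBall.mpr le_rfl)) hx₀.2)
    refine hltW y ?_
    by_contra hyW
    have h1 : dist x₀ c ≤ dist y c :=
      hmin ⟨Metric.mem_closedBall.mpr (hnear y (Metric.ball_subset_closedBall hy)), hyW⟩
    exact absurd (Metric.mem_ball.mp hy) h1.not_gt
  intro x hx
  by_contra hne
  have hxW : x ∈ W := ⟨hx, fun h0 => hne (by linarith [show t * u x - v x = 0 from h0])⟩
  have := h.convex.isPreconnected.subset_of_closure_inter_subset hWo ⟨x, hx, hxW⟩ hclosed hx₁
  exact this.2 (by simp [heq])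

end IsComparisonPair

/-! ### The optimal ratio and the two contradictions -/

section Uniqueness

variable {n : ℕ} {Ω : Set (EuclideanSpace ℝ (Fin n))} {u v : EuclideanSpace ℝ (Fin n) → ℝ}
  {F : EuclideanSpace ℝ (Fin n) → ℝ → ℝ} {k : ℝ}

theorem exists_optimal_ratio {X : Type*} {s : Set X} {f g : X → ℝ} (hf : ∀ x ∈ s, f x < 0)
    (hg : ∀ x ∈ s, g x < 0) {c : ℝ} (hc : 0 < c) (hgf : ∀ x ∈ s, g x ≤ c * f x) {x₀ : X}
    (hx₀ : x₀ ∈ s) (hlt : f x₀ < g x₀) :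
    ∃ t, 0 < t ∧ t < 1 ∧ (∀ x ∈ s, g x ≤ t * f x) ∧
      ∀ t' > t, ¬ ∀ x ∈ s, g x ≤ t' * f x := by
  have hbdd : BddBelow ((fun x => g x / f x) '' s) := ⟨0, by
    rintro _ ⟨x, hx, rfl⟩
    exact (div_pos_of_neg_of_neg (hg x hx) (hf x hx)).le⟩
  have hlow : ∀ t', (∀ x ∈ s, g x ≤ t' * f x) → t' ≤ sInf ((fun x => g x / f x) '' s) :=
    fun t' ht' => le_csInf ⟨_, x₀, hx₀, rfl⟩ (by
      rintro _ ⟨x, hx, rfl⟩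
      exact (le_div_iff_of_neg (hf x hx)).mpr (ht' x hx))
  refine ⟨sInf ((fun x => g x / f x) '' s), hc.trans_le (hlow c hgf), ?_, fun x hx => ?_,
    fun t' ht' h => ht'.not_ge (hlow t' h)⟩
  · refine (csInf_le hbdd ⟨x₀, hx₀, rfl⟩).trans_lt ?_
    exact (div_lt_one_of_neg (hf x₀ hx₀)).mpr hlt
  · exact (le_div_iff_of_neg (hf x hx)).mp (csInf_le hbdd ⟨x, hx, rfl⟩)

/-- Scale by `b / a ∈ [t, 1)` rather than by `t`, then use `t ^ q ≤ (b / a) ^ q`. No monotonicity of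
`G` is needed. -/
theorem rpow_mul_le_of_scaling {q t a b : ℝ} {G : ℝ → ℝ} (hq : 0 ≤ q) (ht : 0 < t) (ht1 : t < 1)
    (hG : ∀ s ≤ 0, 0 ≤ G s)
    (hscale : ∀ s : ℝ, s ≤ 0 → ∀ τ : ℝ, 0 < τ → τ < 1 → τ ^ q * G s ≤ G (τ * s))
    (ha : a < 0) (hab : a ≤ b) (hbt : b ≤ t * a) : t ^ q * G a ≤ G b := by
  have hGa := hG a ha.le
  rcases hab.eq_or_lt with rfl | hlt
  · exact mul_le_of_le_one_left hGa (Real.rpow_le_one ht.le ht1.le hq)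
  · have h1 : t ≤ b / a := (le_div_iff_of_neg ha).mpr hbt
    have h2 : b / a < 1 := (div_lt_one_of_neg ha).mpr hlt
    have h3 := hscale a ha.le (b / a) (ht.trans_le h1) h2
    rw [div_mul_cancel₀ _ ha.ne] at h3
    exact (mul_le_mul_of_nonneg_right (Real.rpow_le_rpow ht.le h1 hq) hGa).trans h3

theorem exists_mem_neg_lt [Nonempty (Fin n)] (hΩ : IsOpen Ω) (hb : Bornology.IsBounded Ω)
    (h0 : (0 : EuclideanSpace ℝ (Fin n)) ∈ Ω) (huc : ContinuousOn u (closure Ω))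
    (hub : ∀ x ∈ frontier Ω, u x = 0) {δ : ℝ} (hδ : 0 < δ) : ∃ x ∈ Ω, -δ < u x := by
  obtain ⟨p, hp⟩ : (frontier Ω).Nonempty := by
    have := Module.punctured_nhds_neBot ℝ (EuclideanSpace ℝ (Fin n)) 0
    obtain ⟨y, hy, hyΩ⟩ := (dense_compl_singleton (0 : EuclideanSpace ℝ (Fin n))).exists_mem_open
      hΩ ⟨0, h0⟩
    obtain ⟨p, hp, -⟩ := exists_frontier_eq_convex_combination hΩ hb hyΩ hy
    exact ⟨p, hp⟩
  have hpcl := frontier_subset_closure hp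
  have := mem_closure_iff_nhdsWithin_neBot.mp hpcl
  have htend : Filter.Tendsto u (𝓝[Ω] p) (𝓝 0) := by
    have := (huc p hpcl).mono subset_closure
    rwa [ContinuousWithinAt, hub p hp] at this
  obtain ⟨x, hx, hxΩ⟩ := ((htend.eventually_const_lt (neg_lt_zero.mpr hδ)).and
    self_mem_nhdsWithin).exists
  exact ⟨x, hxΩ, hx⟩

theorem legendreStar_const_mul {p : EuclideanSpace ℝ (Fin n)} (hu : DifferentiableAt ℝ u p)
    (t : ℝ) : legendreStar (fun x => t * u x) p = t * legendreStar u p := by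
  rw [legendreStar_eq, legendreStar_eq, fderiv_const_mul hu]
  simp
  ring

theorem IsComparisonPair.operator_eq_of_eqOn {t : ℝ} (h : IsComparisonPair k t Ω u v)
    (heq : ∀ x ∈ Ω, v x = t * u x) {p : EuclideanSpace ℝ (Fin n)} (hp : p ∈ Ω) :
    legendreStar v p ^ k * (hessian v p).det
      = t ^ ((n : ℝ) + k) * (legendreStar u p ^ k * (hessian u p).det) := by
  have hud := h.contDiffAt_left p hp
  have hud' := hud.differentiableAt (by norm_num)
  have hev : v =ᶠ[𝓝 p] fun x => t * u x := by
    filter_upwards [h.isOpen.mem_nhds hp] with x hx using heq x hx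
  have h1 : legendreStar v p = t * legendreStar u p := by
    rw [← legendreStar_const_mul hud', legendreStar_eq, legendreStar_eq, hev.fderiv_eq,
      hev.eq_of_nhds]
  have h2 : hessian v p = t • hessian u p := by
    rw [← hessian_const_mul hud, hessian, hessian, hev.fderiv.fderiv_eq]
  have h3 : 0 ≤ legendreStar u p := by
    have := h.convexOn_left.neg_le_legendreStar h.zero_mem hp hud'
    linarith [h.neg_left 0 h.zero_mem]
  rw [h1, h2, Real.mul_rpow h.pos.le h3, Matrix.det_smul, Fintype.card_fin, Real.rpow_add h.pos,
    Real.rpow_natCast]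
  ring

theorem IsConvexSolution.le [Nonempty (Fin n)] (hnk : 0 ≤ (n : ℝ) + k) (hΩ : IsOpen Ω)
    (hb : Bornology.IsBounded Ω) (hconv : Convex ℝ Ω) (h0 : (0 : EuclideanSpace ℝ (Fin n)) ∈ Ω)
    (hF_nonneg : ∀ x ∈ closure Ω, ∀ s : ℝ, s ≤ 0 → 0 ≤ F x s)
    (hF_pos : ∀ x ∈ closure Ω, ∀ s : ℝ, s < 0 → 0 < F x s)
    (hF_scale : ∀ x ∈ closure Ω, ∀ s : ℝ, s ≤ 0 → ∀ t : ℝ, 0 < t → t < 1 →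
      t ^ ((n : ℝ) + k) * F x s ≤ F x (t * s))
    (hF_strict : ∃ δ : ℝ, 0 < δ ∧ ∀ x ∈ closure Ω, ∀ s : ℝ, -δ < s → s < 0 →
      ∀ t : ℝ, 0 < t → t < 1 → t ^ ((n : ℝ) + k) * F x s < F x (t * s))
    {α : ℝ} (hu : MemC2Alpha α Ω u) (hv : MemC2Alpha α Ω v)
    (hu_sol : IsConvexSolution k Ω F u) (hv_sol : IsConvexSolution k Ω F v)
    (hu_ne : ∃ x ∈ Ω, u x ≠ 0) (hv_ne : ∃ x ∈ Ω, v x ≠ 0) : ∀ x ∈ Ω, v x ≤ u x := by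
  by_contra! hlt
  obtain ⟨x₂, hx₂, hlt⟩ := hlt
  obtain ⟨huc, hu2, C, hC, -⟩ := hu
  obtain ⟨hvc, hv2, -⟩ := hv
  have hud : ∀ x ∈ Ω, ContDiffAt ℝ 2 u x := fun x hx => hu2.contDiffAt (hΩ.mem_nhds hx)
  have hvd : ∀ x ∈ Ω, ContDiffAt ℝ 2 v x := fun x hx => hv2.contDiffAt (hΩ.mem_nhds hx)
  have hun : ∀ x ∈ Ω, u x < 0 := fun x hx =>
    hu_sol.convexOn.neg_of_frontier_eq_zero hΩ hb huc hu_sol.boundary hu_ne hx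
  have hvn : ∀ x ∈ Ω, v x < 0 := fun x hx =>
    hv_sol.convexOn.neg_of_frontier_eq_zero hΩ hb hvc hv_sol.boundary hv_ne hx
  obtain ⟨c, hc, hvu⟩ := exists_le_mul_of_frontier_eq_zero hΩ hb hconv h0 huc
    (fun x hx => (hud x hx).differentiableAt (by norm_num)) (fun x hx => (hC x hx).2.1)
    hu_sol.boundary hv_sol.convexOn hv_sol.boundary (hun 0 h0) (hvn 0 h0)
  obtain ⟨t, ht, ht1, htle, hopt⟩ := exists_optimal_ratio hun hvn hc hvu hx₂ hlt
  have hpair : IsComparisonPair k t Ω u v :=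
    { isOpen := hΩ
      isBounded := hb
      convex := hconv
      zero_mem := h0
      pos := ht
      lt_one := ht1
      continuousOn_left := huc
      continuousOn_right := hvc
      contDiffAt_left := hud
      contDiffAt_right := hvd
      convexOn_left := hu_sol.convexOn
      convexOn_right := hv_sol.convexOn
      frontier_left := hu_sol.boundary
      frontier_right := hv_sol.boundary
      neg_left := hun
      neg_right := hvn
      posDef := fun x hx => hu_sol.convexOn.posDef_hessian hΩ hx (hud x hx) (k := k) (by
        rw [hu_sol.equation x hx]
        exact hF_pos x (subset_closure hx) _ (hun x hx))
      bound := ⟨max C 1, by positivity, fun x hx =>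
        ⟨(hC x hx).2.1.trans (le_max_left _ _), (hC x hx).2.2.trans (le_max_left _ _)⟩⟩
      le_mul := htle
      inequality := fun x hx hle => by
        rw [hu_sol.equation x hx, hv_sol.equation x hx]
        exact rpow_mul_le_of_scaling hnk ht ht1 (hF_nonneg x (subset_closure hx))
          (hF_scale x (subset_closure hx)) (hun x hx) hle (htle x hx) }
  by_cases hcontact : ∃ x₁ ∈ Ω, v x₁ = t * u x₁
  · obtain ⟨x₁, hx₁, heq₁⟩ := hcontact
    have heq := hpair.eqOn_of_eq hx₁ heq₁
    obtain ⟨δ, hδ, hstrict⟩ := hF_strict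
    -- Strictness holds only for small `|s|`, so the identity `v = t u` is tested at a point near
    -- the boundary.
    obtain ⟨x, hx, hxδ⟩ := exists_mem_neg_lt hΩ hb h0 huc hu_sol.boundary hδ
    have h1 := hpair.operator_eq_of_eqOn heq hx
    rw [hu_sol.equation x hx, hv_sol.equation x hx, heq x hx] at h1
    exact (hstrict x (subset_closure hx) (u x) hxδ (hun x hx) t ht ht1).ne' h1
  · push Not at hcontact
    obtain ⟨t', ht', hle⟩ := hpair.exists_gt_le_mul fun x hx =>
      (htle x hx).lt_of_ne (hcontact x hx)
    exact hopt t' ht' hle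

end Uniqueness

theorem mainTheorem5 (n : ℕ) (hn : 1 ≤ n) (k : ℝ) (hnk : 0 ≤ (n : ℝ) + k)
    (Ω : Set (EuclideanSpace ℝ (Fin n))) (hΩ : IsSmoothStrictlyConvexDomain Ω)
    (h0 : (0 : EuclideanSpace ℝ (Fin n)) ∈ Ω)
    (F : EuclideanSpace ℝ (Fin n) → ℝ → ℝ)
    (hF_nonneg : ∀ x ∈ closure Ω, ∀ s : ℝ, s ≤ 0 → 0 ≤ F x s)
    (hF_pos : ∀ x ∈ closure Ω, ∀ s : ℝ, s < 0 → 0 < F x s)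
    (hF_scale : ∀ x ∈ closure Ω, ∀ s : ℝ, s ≤ 0 → ∀ t : ℝ, 0 < t → t < 1 →
      t ^ ((n : ℝ) + k) * F x s ≤ F x (t * s))
    (hF_strict : ∃ δ : ℝ, 0 < δ ∧ ∀ x ∈ closure Ω, ∀ s : ℝ, -δ < s → s < 0 →
      ∀ t : ℝ, 0 < t → t < 1 → t ^ ((n : ℝ) + k) * F x s < F x (t * s))
    (α : ℝ) (hα0 : 0 < α) (hα1 : α < 1)
    (u v : EuclideanSpace ℝ (Fin n) → ℝ)
    (hu : MemC2Alpha α Ω u) (hv : MemC2Alpha α Ω v)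
    (hu_sol : IsConvexSolution k Ω F u) (hv_sol : IsConvexSolution k Ω F v)
    (hu_ne : ∃ x ∈ Ω, u x ≠ 0) (hv_ne : ∃ x ∈ Ω, v x ≠ 0) :
    Set.EqOn u v (closure Ω) := by
  have : Nonempty (Fin n) := ⟨⟨0, hn⟩⟩
  intro x hx
  by_cases hxΩ : x ∈ Ω
  · refine le_antisymm ?_ ?_
    · exact hv_sol.le hnk hΩ.isOpen hΩ.isBounded hΩ.convex h0 hF_nonneg hF_pos hF_scale hF_strict
        hv hu hu_sol hv_ne hu_ne x hxΩ
    · exact hu_sol.le hnk hΩ.isOpen hΩ.isBounded hΩ.convex h0 hF_nonneg hF_pos hF_scale hF_strict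
        hu hv hv_sol hu_ne hv_ne x hxΩ
  · have hf : x ∈ frontier Ω := hΩ.isOpen.frontier_eq ▸ ⟨hx, hxΩ⟩
    rw [hu_sol.boundary x hf, hv_sol.boundary x hf]
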